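/- Let $\Sigma$ be a finite alphabet. For words $u, w \in \Sigma^*$ let $|w|_u$ denote the number of occurrences of $u$ in $w$, that is, the number of pairs $(x, y)$ of words with $w = xuy$ (so overlapping occurrences are counted, and $u$ may be empty). A language $X \subseteq \Sigma^*$ is a separating set of factors of a language $L \subseteq \Sigma^*$ if for all distinct words $u, v \in L$ there exists $x \in X$ such that $|u|_x \neq |v|_x$. For an integer $k \geq 1$, words $u, v \in \Sigma^*$ are $k$-abelian equivalent if $|u|_x = |v|_x$ for all words $x \in \Sigma^*$ of length at most $k$. Theorem. Let $L \subseteq \Sigma^*$ be a regular language. Then $L$ has a finite separating set of factors if and only if there are no words $w, x, y, z \in \Sigma^*$ such that $wy \neq yw$ and $x w^* y w^* z \subseteq L$. Moreover, $L$ has a finite separating set of factors if and only if there exists an integer $k \geq 1$ such that no two distinct words of $L$ are $k$-abelian equivalent. -/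

import Mathlib

namespace SepFactors

/-- The occurrences of the word `u` in the word `w`: an occurrence `(x, u, y)` with `w = x u y`
is recorded as the pair `(x, y)`. -/
def occurrences {α : Type*} (u w : List α) : Set (List α × List α) :=
  {p | w = p.1 ++ u ++ p.2}

theorem occurrences_finite {α : Type*} (u w : List α) : (occurrences u w).Finite := by
  refine Set.Finite.subset
    ((List.finite_toSet w.inits).prod (List.finite_toSet w.tails)) ?_
  rintro ⟨x, y⟩ h
  have h' : w = x ++ u ++ y := h
  subst h'
  refine ⟨?_, ?_⟩
  · exact (List.mem_inits _ _).2 ⟨u ++ y, by simp⟩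
  · exact (List.mem_tails _ _).2 ⟨x ++ u, by simp⟩

/-- The number `|w|_u` of (possibly overlapping) occurrences of `u` in `w`; the set that is
counted is finite by `occurrences_finite`. -/
noncomputable def occ {α : Type*} (u w : List α) : ℕ :=
  (occurrences u w).ncard

/-- `X` is a separating set of factors of `L`. -/
def IsSSF {α : Type*} (X L : Language α) : Prop :=
  ∀ u ∈ L, ∀ v ∈ L, u ≠ v → ∃ x ∈ X, occ x u ≠ occ x v

/-- `L` has a finite separating set of factors. -/
def HasFiniteSSF {α : Type*} (L : Language α) : Prop :=
  ∃ X : Language α, Set.Finite {x | x ∈ X} ∧ IsSSF X L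

/-- `k`-abelian equivalence of words. -/
def KAbelianEquiv {α : Type*} (k : ℕ) (u v : List α) : Prop :=
  ∀ x : List α, x.length ≤ k → occ x u = occ x v

/-- The language `x w* y w* z`. -/
def starPattern {α : Type*} (w x y z : List α) : Language α :=
  {x} * KStar.kstar {w} * {y} * KStar.kstar {w} * {z}

end SepFactors

namespace SepFactors

variable {α : Type*}

/-! If `w` and `y` do not commute, `x w^(k+1) y w^k z` and `x w^k y w^(k+1) z` are distinct but
k-abelian equivalent, so the pattern rules out separation (`kAbelianEquiv_move`). Conversely, let a
long factor occur twice in a word of `L`. Pigeonhole on pairs of automaton states gives one word `w`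
looping at both places; with the pattern excluded, `w` commutes with the word `y` between them, and
this forces a local period that predicts the next letter (`exists_repeatsContinue`). Factor counts
then determine the word letter by letter (`eq_of_kAbelianEquiv`). -/

/-! ### Counting occurrences -/

open Classical in
theorem occ_nil (t : List α) : occ t [] = if t <+: [] then 1 else 0 := by
  unfold occ
  split_ifs with h
  · have ht : t = [] := List.prefix_nil.1 h
    subst ht
    have : occurrences ([] : List α) [] = {([], [])} := by
      ext ⟨x, y⟩
      simp [occurrences]
    rw [this, Set.ncard_singleton]
  · have : occurrences t [] = ∅ := by
      ext ⟨x, y⟩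
      simp only [occurrences, Set.mem_ofPred_eq, Set.mem_empty_iff_false, iff_false]
      intro h'
      simp at h'
      exact h (by simp [h'.2.1])
    rw [this, Set.ncard_empty]

open Classical in
theorem occ_cons (t : List α) (h : α) (l : List α) :
    occ t (h :: l) = occ t l + if t <+: h :: l then 1 else 0 := by
  let f : List α × List α → List α × List α := fun p => (h :: p.1, p.2)
  let S : Set (List α × List α) := {p | p.1 = [] ∧ h :: l = t ++ p.2}
  have hf : Function.Injective f := by
    rintro ⟨a, b⟩ ⟨c, d⟩ hab
    simpa [f] using hab
  have hU : occurrences t (h :: l) = f '' occurrences t l ∪ S := by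
    ext ⟨x, y⟩
    cases x with
    | nil => simp [occurrences, f, S]
    | cons a x =>
      simp only [occurrences, f, S, Set.mem_ofPred_eq, Set.mem_union, Set.mem_image, Prod.exists,
        Prod.mk.injEq, List.cons.injEq, List.cons_append, reduceCtorEq, false_and, or_false]
      constructor
      · rintro ⟨rfl, h2⟩
        exact ⟨x, y, h2, ⟨rfl, rfl⟩, rfl⟩
      · rintro ⟨_, _, h2, ⟨rfl, rfl⟩, rfl⟩
        exact ⟨rfl, h2⟩
  have hS : S.ncard = if t <+: h :: l then 1 else 0 := by
    split_ifs with hp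
    · obtain ⟨s, hs⟩ := hp
      have : S = {([], s)} := by
        ext ⟨x, y⟩
        simp [S, ← hs, eq_comm]
      rw [this, Set.ncard_singleton]
    · have : S = ∅ := by
        ext ⟨x, y⟩
        simp only [S, Set.mem_ofPred_eq, Set.mem_empty_iff_false, iff_false]
        rintro ⟨-, h2⟩
        exact hp ⟨y, h2.symm⟩
      rw [this, Set.ncard_empty]
  have hSf : S.Finite := (occurrences_finite t (h :: l)).subset (hU ▸ Set.subset_union_right)
  unfold occ
  rw [hU, Set.ncard_union_eq _ ((occurrences_finite t l).image f) hSf,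
    Set.ncard_image_of_injective _ hf, hS]
  rw [Set.disjoint_left]
  rintro ⟨x, y⟩ ⟨p, -, hp⟩ ⟨h1, -⟩
  simp only [f, Prod.mk.injEq] at hp h1
  simp [h1] at hp

theorem occ_pos_iff (t w : List α) : 0 < occ t w ↔ t <:+: w := by
  unfold occ
  rw [Set.ncard_pos (occurrences_finite t w)]
  constructor
  · rintro ⟨⟨x, y⟩, h⟩
    exact ⟨x, y, Eq.symm h⟩
  · rintro ⟨x, y, h⟩
    exact ⟨(x, y), Eq.symm h⟩

theorem occ_nil_left (w : List α) : occ [] w = w.length + 1 := by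
  induction w with
  | nil => simp [occ_nil]
  | cons h l ih => simp [occ_cons, ih]

/-- Occurrences of `t` in `a ++ b ++ c` lie in `a ++ b` or in `b ++ c`, and in both exactly when
they lie in `b`, provided that `b` is long enough. -/
theorem occ_append_overlap (t a b c : List α) (hb : t.length ≤ b.length + 1) :
    occ t (a ++ (b ++ c)) + occ t b = occ t (a ++ b) + occ t (b ++ c) := by
  classical
  induction a with
  | nil => simp [add_comm]
  | cons h a ih =>
    have hp : t <+: h :: (a ++ (b ++ c)) ↔ t <+: h :: (a ++ b) := by
      constructor
      · intro hp
        refine List.prefix_of_prefix_length_le hp ⟨c, by simp⟩ ?_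
        simp only [List.length_cons, List.length_append]
        omega
      · exact fun hp => hp.trans ⟨c, by simp⟩
    simp only [List.cons_append, occ_cons, hp]
    omega

-- Every occurrence of `s` other than a prefix is preceded by exactly one letter. Hence factor
-- counts reveal short prefixes.
open Classical in
theorem sum_occ_cons_add [Fintype α] (s w : List α) :
    (∑ a, occ (a :: s) w) + (if s <+: w then 1 else 0) = occ s w := by
  induction w with
  | nil => simp [occ_nil]
  | cons h l ih =>
    have : (∑ a, if a :: s <+: h :: l then 1 else 0) = if s <+: l then 1 else 0 := by
      simp only [List.cons_prefix_cons]
      by_cases hs : s <+: l <;> simp [hs]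
    simp only [occ_cons, Finset.sum_add_distrib, this]
    rw [ih]

theorem KAbelianEquiv.length_eq {k : ℕ} {u v : List α} (h : KAbelianEquiv k u v) :
    u.length = v.length := by
  have := h [] (by simp)
  rw [occ_nil_left, occ_nil_left] at this
  omega

theorem KAbelianEquiv.prefix_iff [Finite α] {k : ℕ} {u v s : List α}
    (h : KAbelianEquiv k u v) (hs : s.length + 1 ≤ k) : s <+: u ↔ s <+: v := by
  classical
  have := Fintype.ofFinite α
  have hu := sum_occ_cons_add s u
  have hv := sum_occ_cons_add s v
  rw [h s (by omega), ← hv, Finset.sum_congr rfl fun a _ => h (a :: s) (by simpa using hs)] at hu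
  have := Nat.add_left_cancel hu
  by_cases h1 : s <+: u <;> by_cases h2 : s <+: v <;> simp_all

/-! ### Reconstructing a word from its factor counts -/

/-- Every factor of `u` of length `K` that occurs again later in `u` is followed by the letter
`D` positions back. -/
def RepeatsContinue (K D : ℕ) (u : List α) : Prop :=
  ∀ i j, i < j → j + K ≤ u.length → (∀ l < K, u[i + l]? = u[j + l]?) →
    u[i + K]? = u[i + K - D]?

theorem RepeatsContinue.next_letter {K D : ℕ} {p t r : List α} {a : α} (hD : 0 < D)
    (hDK : D ≤ K) (hu : RepeatsContinue K D (p ++ (t ++ a :: r))) (ht : t.length = K)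
    (hr : t <:+: (t ++ a :: r).tail) : t[K - D]? = some a := by
  obtain ⟨x, y, hxy⟩ := hr
  have hne : t ++ a :: r ≠ [] := by simp
  obtain ⟨h, l, hl⟩ := List.exists_cons_of_ne_nil hne
  rw [hl, List.tail_cons] at hxy
  have hw : p ++ (t ++ a :: r) = (p ++ h :: x) ++ (t ++ y) := by
    rw [hl, ← hxy]
    simp
  have hlen := congrArg List.length hw
  simp only [List.length_append, List.length_cons] at hlen
  have key := hu p.length (p.length + x.length + 1) (by omega)
    (by simp only [List.length_append, List.length_cons]; omega) (by
      intro l hlK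
      rw [List.getElem?_append_right (by omega), Nat.add_sub_cancel_left,
        List.getElem?_append_left (by omega), hw,
        List.getElem?_append_right (by simp; omega), List.getElem?_append_left (by simp; omega)]
      congr 1
      simp only [List.length_append, List.length_cons]
      omega)
  rw [List.getElem?_append_right (by omega), Nat.add_sub_cancel_left,
    List.getElem?_append_right (by omega), List.getElem?_append_right (by omega),
    List.getElem?_append_left (by omega), ht] at key
  simp only [Nat.sub_self, List.getElem?_cons_zero] at key
  rw [key]
  congr 1
  omega

/-- Cancelling `p` leaves equal counts for the two remainders. If `t` recurs in one, it recurs in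
both, and both next letters are `t[K - D]`. Otherwise `t` occurs only at the front, so the
occurrence of `t ++ [a]` must sit there too. -/
theorem next_letter_eq {K D : ℕ} {p t r s : List α} {a b : α} (hD : 0 < D) (hDK : D ≤ K)
    (hu : RepeatsContinue K D (p ++ (t ++ a :: r))) (hv : RepeatsContinue K D (p ++ (t ++ b :: s)))
    (ht : t.length = K) (h : KAbelianEquiv (K + 1) (p ++ (t ++ a :: r)) (p ++ (t ++ b :: s))) :
    a = b := by
  classical
  have hcount : ∀ q : List α, q.length ≤ K + 1 → occ q (t ++ a :: r) = occ q (t ++ b :: s) := by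
    intro q hq
    have h1 := occ_append_overlap q p t (a :: r) (by omega)
    have h2 := occ_append_overlap q p t (b :: s) (by omega)
    have h3 := h q hq
    omega
  have htail : ∀ (q : List α) (c : α) (m : List α), occ q (t ++ c :: m)
      = occ q (t ++ c :: m).tail + if q <+: t ++ c :: m then 1 else 0 := by
    intro q c m
    obtain ⟨h, l, hl⟩ := List.exists_cons_of_ne_nil (show t ++ c :: m ≠ [] by simp)
    rw [hl, List.tail_cons, occ_cons]
  have ht_tail : occ t (t ++ a :: r).tail = occ t (t ++ b :: s).tail := by
    have h1 := htail t a r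
    have h2 := htail t b s
    have h3 := hcount t (by omega)
    simp only [List.prefix_append, if_true] at h1 h2
    omega
  by_cases hz : 0 < occ t (t ++ a :: r).tail
  · have h1 := hu.next_letter hD hDK ht ((occ_pos_iff _ _).1 hz)
    have h2 := hv.next_letter hD hDK ht ((occ_pos_iff _ _).1 (ht_tail ▸ hz))
    exact Option.some.inj (h1.symm.trans h2)
  · by_contra hab
    have hpos : 0 < occ (t ++ [a]) (t ++ b :: s) := by
      rw [← hcount _ (by simp [ht]), occ_pos_iff]
      exact ⟨[], r, by simp⟩
    have hnp : ¬ t ++ [a] <+: t ++ b :: s := by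
      simp [List.prefix_append_right_inj, hab]
    rw [htail, if_neg hnp, add_zero, occ_pos_iff] at hpos
    have : 0 < occ t (t ++ b :: s).tail :=
      (occ_pos_iff _ _).2 ((List.prefix_append t [a]).isInfix.trans hpos)
    omega

theorem eq_of_kAbelianEquiv [Finite α] {K D : ℕ} {u v : List α} (hD : 0 < D) (hDK : D ≤ K)
    (hu : RepeatsContinue K D u) (hv : RepeatsContinue K D v) (h : KAbelianEquiv (K + 1) u v) :
    u = v := by
  have hlen := h.length_eq
  have hpre : ∀ l ≤ u.length, u.take l <+: v := by
    intro l
    induction l with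
    | zero => simp
    | succ l ih =>
      intro hl
      by_cases hlK : l + 1 ≤ K
      · exact (h.prefix_iff (by simp; omega)).1 (List.take_prefix _ _)
      · have hp := List.prefix_iff_eq_take.1 (ih (by omega))
        rw [List.length_take, min_eq_left (by omega)] at hp
        have hsplit : ∀ w : List α, ∀ hw : l < w.length, w =
            (w.take l).take (l - K) ++ ((w.take l).drop (l - K) ++ w[l] :: w.drop (l + 1)) := by
          intro w hw
          rw [← List.append_assoc, List.take_append_drop, List.cons_getElem_drop_succ,
            List.take_append_drop]
        have hu' := hsplit u (by omega)
        have hv' := hsplit v (by omega)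
        rw [← hp] at hv'
        have heq : u[l] = v[l] := by
          refine next_letter_eq (p := (u.take l).take (l - K)) (t := (u.take l).drop (l - K))
            (r := u.drop (l + 1)) (s := v.drop (l + 1)) hD hDK ?_ ?_ ?_ ?_
          · rwa [← hu']
          · rwa [← hv']
          · simp only [List.length_drop, List.length_take]
            omega
          · rwa [← hu', ← hv']
        rw [List.take_succ_eq_append_getElem (by omega), heq, hp,
          ← List.take_succ_eq_append_getElem]
        exact List.take_prefix _ _
  have := hpre u.length le_rfl
  rw [List.take_length] at this
  exact this.eq_of_length hlen

/-! ### The pattern prevents separation -/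

theorem mem_starPattern {w x y z u : List α} : u ∈ starPattern w x y z ↔
    ∃ m n : ℕ, u = x ++ (List.replicate m w).flatten ++ y ++ (List.replicate n w).flatten ++ z := by
  have hk : ∀ v : List α, v ∈ KStar.kstar ({w} : Language α) ↔
      ∃ m, v = (List.replicate m w).flatten := by
    intro v
    rw [Language.mem_kstar]
    constructor
    · rintro ⟨S, rfl, hS⟩
      exact ⟨S.length, by rw [← List.eq_replicate_of_mem fun b hb => hS b hb]⟩
    · rintro ⟨m, rfl⟩
      exact ⟨_, rfl, fun y hy => List.eq_of_mem_replicate hy⟩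
  unfold starPattern
  constructor
  · rintro ⟨_, ⟨_, ⟨_, ⟨_, rfl, b, hb, rfl⟩, _, rfl, rfl⟩, c, hc, rfl⟩, _, rfl, rfl⟩
    obtain ⟨m, rfl⟩ := (hk b).1 hb
    obtain ⟨n, rfl⟩ := (hk c).1 hc
    exact ⟨m, n, rfl⟩
  · rintro ⟨m, n, rfl⟩
    exact ⟨_, ⟨_, ⟨_, ⟨_, rfl, _, (hk _).2 ⟨m, rfl⟩, rfl⟩, _, rfl, rfl⟩, _, (hk _).2 ⟨n, rfl⟩, rfl⟩,
      _, rfl, rfl⟩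

/-- Cutting at the long overlaps `A` splits both words into the same blocks `xA`, `wA`, `AyA`, `Az`.
-/
theorem kAbelianEquiv_move {k : ℕ} {A w x y z : List α} (hA : k ≤ A.length)
    (hw : w ++ A = A ++ w) :
    KAbelianEquiv k (x ++ (w ++ (A ++ (y ++ (A ++ z))))) (x ++ (A ++ (y ++ (w ++ (A ++ z))))) := by
  intro t ht
  have hw' : ∀ r, w ++ (A ++ r) = A ++ (w ++ r) := by
    intro r
    rw [← List.append_assoc, hw, List.append_assoc]
  have o := fun a c => occ_append_overlap t a A c (by omega)
  have e1 := o (x ++ w) (y ++ (A ++ z))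
  have e2 := o y z
  have e2' := o (A ++ y) z
  have e3 := o x w
  have e4 := o x (y ++ (w ++ (A ++ z)))
  have e5 := o (A ++ y) (w ++ z)
  have e6 := o w z
  simp only [List.append_assoc, hw', hw] at *
  omega

theorem exists_kAbelianEquiv_of_starPattern_le {L : Language α} {w x y z : List α}
    (hwy : w ++ y ≠ y ++ w) (hL : starPattern w x y z ≤ L) (k : ℕ) :
    ∃ u ∈ L, ∃ v ∈ L, u ≠ v ∧ KAbelianEquiv k u v := by
  have hw : 1 ≤ w.length := by
    rw [Nat.one_le_iff_ne_zero, Ne, List.length_eq_zero_iff]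
    rintro rfl
    simp at hwy
  set A := (List.replicate k w).flatten with hA
  have hlen : k ≤ A.length := by
    simp only [hA, List.length_flatten, List.map_replicate, List.sum_replicate, smul_eq_mul]
    exact Nat.le_mul_of_pos_right k hw
  have hsucc : (List.replicate (k + 1) w).flatten = w ++ A := by
    rw [List.replicate_succ, List.flatten_cons]
  have hcomm : w ++ A = A ++ w := by
    rw [← hsucc, List.replicate_succ', List.flatten_append]
    simp [hA]
  refine ⟨x ++ (w ++ (A ++ (y ++ (A ++ z)))), hL (mem_starPattern.2 ⟨k + 1, k, ?_⟩),
    x ++ (A ++ (y ++ (w ++ (A ++ z)))), hL (mem_starPattern.2 ⟨k, k + 1, ?_⟩), ?_,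
    kAbelianEquiv_move hlen hcomm⟩
  · rw [hsucc]; simp [← hA]
  · rw [hsucc]; simp [← hA]
  · rw [← List.append_assoc w A, hcomm]
    simp only [List.append_assoc, Ne, List.append_cancel_left_eq]
    simp only [← List.append_assoc, List.append_cancel_right_eq]
    exact hwy

/-! ### Regularity without the pattern forces periodicity -/

/-- Period `|w|` holds at the start because `yw = wy`, and period `|y|` carries it up to `N`. -/
theorem getElem?_add_mul_of_comm {w y u : List α} {N c : ℕ} (hcomm : w ++ y = y ++ w)
    (hy : 0 < y.length) (hpre : y ++ w <+: u)
    (hper : ∀ l, l + y.length < N → u[l]? = u[l + y.length]?) :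
    ∀ l, l + c * w.length < N → u[l + c * w.length]? = u[l]? := by
  have hone : ∀ l, l + w.length < N → u[l + w.length]? = u[l]? := by
    intro l
    induction l using Nat.strong_induction_on with
    | _ l ih =>
      intro hl
      by_cases hly : l < y.length
      · obtain ⟨r, rfl⟩ := hpre
        rw [List.getElem?_append_left (by simp; omega), ← hcomm,
          List.getElem?_append_right (by omega), Nat.add_sub_cancel, hcomm,
          List.append_assoc, List.getElem?_append_left hly]
      · have h1 := ih (l - y.length) (by omega) (by omega)
        have h2 := hper (l - y.length) (by omega)
        have h3 := hper (l - y.length + w.length) (by omega)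
        rw [show l - y.length + y.length = l by omega] at h2
        rw [show l - y.length + w.length + y.length = l + w.length by omega] at h3
        rw [← h3, h1, h2]
  intro l
  induction c with
  | zero => simp
  | succ c ih =>
    intro hl
    rw [Nat.add_one_mul, ← add_assoc] at hl ⊢
    rw [hone _ hl, ih (by omega)]

theorem starPattern_le_accepts {σ : Type*} (M : DFA α σ) {w x y z : List α}
    (h1 : M.eval (x ++ w) = M.eval x) (h2 : M.eval (x ++ y ++ w) = M.eval (x ++ y))
    (h : x ++ y ++ z ∈ M.accepts) : starPattern w x y z ≤ M.accepts := by
  have hloop : ∀ (s : σ) (m : ℕ), M.evalFrom s w = s →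
      M.evalFrom s (List.replicate m w).flatten = s := by
    intro s m hs
    induction m with
    | zero => rfl
    | succ m ih => rw [List.replicate_succ, List.flatten_cons, DFA.evalFrom_of_append, hs, ih]
  intro u hu
  obtain ⟨m, n, rfl⟩ := mem_starPattern.1 hu
  refine M.mem_accepts.2 ?_
  simp only [DFA.mem_accepts, DFA.eval, DFA.evalFrom_of_append] at h h1 h2 ⊢
  rwa [hloop _ _ h1, hloop _ _ h2]

theorem exists_repeatsContinue {L : Language α} (hL : L.IsRegular)
    (hno : ¬ ∃ w x y z : List α, w ++ y ≠ y ++ w ∧ starPattern w x y z ≤ L) :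
    ∃ K D : ℕ, 0 < D ∧ D ≤ K ∧ ∀ u ∈ L, RepeatsContinue K D u := by
  obtain ⟨σ, hσ, M, rfl⟩ := hL
  set n := Fintype.card (σ × σ) with hn
  -- The loop length is at most `n`, so it divides `n!`; going back `n!` from `i + K` lands at `i +
  -- n`, not before the loop starts.
  refine ⟨n + n.factorial, n.factorial, Nat.factorial_pos n, by omega, ?_⟩
  intro u hu i j hij hj hrep
  obtain ⟨m, m', hne, hmm⟩ := Fintype.exists_ne_map_eq_of_card_lt
    (fun m : Fin (n + 1) => (M.eval (u.take (i + m)), M.eval (u.take (j + m)))) (by simp [hn])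
  wlog hlt : m < m' generalizing m m'
  · exact this m' m hne.symm hmm.symm (lt_of_le_of_ne (not_lt.1 hlt) hne.symm)
  obtain ⟨m, hm⟩ := m
  obtain ⟨m', hm'⟩ := m'
  simp only [Prod.mk.injEq, Fin.mk_lt_mk] at hmm hlt
  set y := (u.drop (i + m)).take (j - i) with hy
  set w := (u.drop (j + m)).take (m' - m) with hw
  have hyl : y.length = j - i := by
    simp only [hy, List.length_take, List.length_drop]
    omega
  have hwl : w.length = m' - m := by
    simp only [hw, List.length_take, List.length_drop]
    omega
  have hxy : u.take (i + m) ++ y = u.take (j + m) := by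
    rw [hy, ← List.take_add]
    congr 1
    omega
  have hxyw : u.take (j + m) ++ w = u.take (j + m') := by
    rw [hw, ← List.take_add]
    congr 1
    omega
  have hw' : w = (u.drop (i + m)).take (m' - m) := by
    apply List.ext_getElem?
    intro l
    rw [hw, List.getElem?_take, List.getElem?_take]
    split_ifs with hl
    · rw [List.getElem?_drop, List.getElem?_drop, add_assoc, add_assoc, hrep (m + l) (by omega)]
    · rfl
  have hxw : u.take (i + m) ++ w = u.take (i + m') := by
    rw [hw', ← List.take_add]
    congr 1
    omega
  have hcomm : w ++ y = y ++ w := by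
    by_contra hc
    refine hno ⟨w, u.take (i + m), y, u.drop (j + m), hc, starPattern_le_accepts M ?_ ?_ ?_⟩
    · rw [hxw, hmm.1]
    · rw [hxy, hxyw, hmm.2]
    · rwa [hxy, List.take_append_drop]
  have hpre : y ++ w <+: u.drop (i + m) := by
    have : y ++ w = (u.drop (i + m)).take (j - i + (m' - m)) := by
      rw [List.take_add, ← hy, List.drop_drop, show i + m + (j - i) = j + m by omega]
    rw [this]
    exact List.take_prefix _ _
  obtain ⟨c, hc⟩ : w.length ∣ n.factorial := Nat.dvd_factorial (by omega) (by omega)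
  -- The repeated factor gives `u` the period `j - i` up to position `j + K`; `N` is that bound
  -- measured from `i + m`.
  have key := getElem?_add_mul_of_comm (N := j - i + (n + n.factorial) - m) (c := c) hcomm
    (by omega) hpre (by
      intro l hl
      rw [List.getElem?_drop, List.getElem?_drop, add_assoc, hrep (m + l) (by omega)]
      congr 1
      omega) (n - m) (by rw [mul_comm, ← hc]; omega)
  rw [mul_comm, ← hc, List.getElem?_drop, List.getElem?_drop] at key
  rw [show i + (n + n.factorial) = i + m + (n - m + n.factorial) by omega, key]
  congr 1
  omega

theorem hasFiniteSSF_iff [Finite α] (L : Language α) : HasFiniteSSF L ↔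
    ∃ k : ℕ, 1 ≤ k ∧ ∀ u ∈ L, ∀ v ∈ L, u ≠ v → ¬ KAbelianEquiv k u v := by
  constructor
  · rintro ⟨X, hX, hsep⟩
    obtain ⟨k, hk⟩ := (hX.image List.length).bddAbove
    refine ⟨k + 1, by omega, fun u hu v hv huv h => ?_⟩
    obtain ⟨x, hx, hne⟩ := hsep u hu v hv huv
    exact hne (h x ((hk ⟨x, hx, rfl⟩).trans (Nat.le_succ k)))
  · rintro ⟨k, -, hk⟩
    refine ⟨{x | x.length ≤ k}, List.finite_length_le α k, fun u hu v hv huv => ?_⟩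
    have := hk u hu v hv huv
    simp only [KAbelianEquiv, not_forall] at this
    obtain ⟨x, hx, hne⟩ := this
    exact ⟨x, hx, hne⟩

end SepFactors

theorem mainTheorem1 {α : Type*} [Finite α] (L : Language α) (hL : L.IsRegular) :
    (SepFactors.HasFiniteSSF L ↔
      ¬ ∃ w x y z : List α, w ++ y ≠ y ++ w ∧ SepFactors.starPattern w x y z ≤ L) ∧
    (SepFactors.HasFiniteSSF L ↔
      ∃ k : ℕ, 1 ≤ k ∧ ∀ u ∈ L, ∀ v ∈ L, u ≠ v → ¬ SepFactors.KAbelianEquiv k u v) := by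
  refine ⟨?_, SepFactors.hasFiniteSSF_iff L⟩
  rw [SepFactors.hasFiniteSSF_iff]
  constructor
  · rintro ⟨k, -, hk⟩ ⟨w, x, y, z, hwy, hle⟩
    obtain ⟨u, hu, v, hv, huv, h⟩ :=
      SepFactors.exists_kAbelianEquiv_of_starPattern_le hwy hle k
    exact hk u hu v hv huv h
  · intro hno
    obtain ⟨K, D, hD, hDK, hrep⟩ := SepFactors.exists_repeatsContinue hL hno
    exact ⟨K + 1, by omega, fun u hu v hv huv h =>
      huv (SepFactors.eq_of_kAbelianEquiv hD hDK (hrep u hu) (hrep v hv) h)⟩
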